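/- Consider unweighted max-sat: an instance of size $n$ consists of $n$ Boolean variables $x_1,\dots,x_n$, listed in order of arrival, and a finite family of named clauses, each a set of literals (distinct names may carry the same set of literals), such that every variable occurs in some clause. The value of an assignment is the number of named clauses it satisfies, and $\mathrm{OPT}(I)$ is the maximum value over all assignments. In input model 0 the data item of a variable consists only of the names (and weights, all equal to $1$) of the clauses in which it appears positively and of those in which it appears negatively. A deterministic online width-$k$ algorithm knows $n$ and maintains a set of partial assignments, initially only the empty one. When the data item of $x_i$ arrives, each current partial assignment is irrevocably extended by a value of $x_i$ or is split into both extensions, on the basis of the data items received so far, $x_i$'s included, and the decisions made so far; no partial assignment may be discarded, and at no time may there be more than $k$ of them. The value $v(\mathbb A,I)$ obtained by the algorithm $\mathbb A$ on the instance $I$ is that of the best complete assignment it holds at the end. Theorem. For every constant $k$, every online width-$k$ algorithm $\mathbb A$ for unweighted max-sat in input model 0 has asymptotic approximation ratio strictly less than $2/3$, that is, $$\liminf_{n\to\infty}\ \inf_{I \text{ of size } n}\ \frac{v(\mathbb A,I)}{\mathrm{OPT}(I)} < \frac23 .$$ -/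

import Mathlib

open scoped ENNReal

namespace MaxSat

/-- A literal over the variables `x_0, …, x_{n-1}`: `(i, true)` is `x_i`, `(i, false)` is its
negation. -/
abbrev Literal (n : ℕ) : Type := Fin n × Bool

/-- An instance of unweighted max-sat of size `n` (i.e. with `n` data items), together with the
order of arrival: variable `i` is the one that arrives in step `i`. The clauses are identified by
names, so equal sets of literals may occur under several names. Every variable occurs in some
clause (this also rules out instances of optimal value zero, as soon as `n ≠ 0`). -/
structure Instance (n : ℕ) where
  /-- the finite set of clause names -/
  names : Finset ℕ
  /-- the set of literals of the clause with a given name -/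
  lits : ℕ → Finset (Literal n)
  /-- every variable occurs, positively or negatively, in some clause -/
  occurs : ∀ i : Fin n, ∃ c ∈ names, ∃ b : Bool, (i, b) ∈ lits c

/-- A data item in input model 0: the names of the clauses in which the variable appears
positively and the names of those in which it appears negatively (all weights are 1). -/
structure DataItem where
  /-- names of the clauses that contain the variable -/
  pos : Finset ℕ
  /-- names of the clauses that contain the negation of the variable -/
  neg : Finset ℕ

namespace Instance

variable {n : ℕ}

/-- The data item of variable `i`. -/
def item (I : Instance n) (i : Fin n) : DataItem where
  pos := I.names.filter fun c => (i, true) ∈ I.lits c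
  neg := I.names.filter fun c => (i, false) ∈ I.lits c

/-- The first `i` data items, the most recent one first. -/
def history (I : Instance n) (i : ℕ) : List DataItem :=
  ((List.ofFn I.item).take i).reverse

/-- The number of clauses satisfied by an assignment. -/
def numSat (I : Instance n) (a : Fin n → Bool) : ℕ :=
  (I.names.filter fun c => ∃ l ∈ I.lits c, a l.1 = l.2).card

/-- The optimal value: the largest number of clauses satisfied by an assignment. -/
def opt (I : Instance n) : ℕ :=
  Finset.univ.sup I.numSat

theorem opt_pos (hn : 0 < n) (I : Instance n) : 0 < I.opt := by
  obtain ⟨c, hc, b, hb⟩ := I.occurs ⟨0, hn⟩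
  refine lt_of_lt_of_le ?_ (Finset.le_sup (f := I.numSat) (Finset.mem_univ fun _ => b))
  exact Finset.card_pos.2 ⟨c, Finset.mem_filter.2 ⟨hc, _, hb, rfl⟩⟩

end Instance

/-- A deterministic online algorithm that maintains a tree of possible solutions, may branch at
any time and never cuts. It knows the size `n`. A partial solution is the list of the truth values
given to the variables seen so far, the most recent one first. When a data item arrives, the
partial solution `s` is replaced by its extensions by the values in `branch n h s`, where `h` is
the list of all the data items seen so far, the most recent one (that of the current variable)
first. Since the algorithm is deterministic, `h` determines the whole current tree. -/
structure OnlineAlgorithm where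
  /-- the truth values given to the current variable in the children of a node -/
  branch : (n : ℕ) → (h : List DataItem) → (s : List Bool) → Finset Bool
  /-- no cutting: every node has at least one child -/
  branch_nonempty : ∀ n h s, (branch n h s).Nonempty

namespace OnlineAlgorithm

/-- The set of possible solutions maintained after the data items in `h` (the most recent one
first) have been processed: one level of the tree. -/
def level (A : OnlineAlgorithm) (n : ℕ) : List DataItem → Finset (List Bool)
  | [] => {[]}
  | d :: h => (A.level n h).biUnion fun s => (A.branch n (d :: h) s).image fun b => b :: s

/-- The algorithm has width `k`: on every instance, at every point in time, it maintains at most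
`k` possible solutions. -/
def HasWidth (A : OnlineAlgorithm) (k : ℕ) : Prop :=
  ∀ (n : ℕ) (I : Instance n), ∀ i ≤ n, (A.level n (I.history i)).card ≤ k

/-- The assignment described by a complete solution (a list of length `n`, latest value first). -/
def toAssignment (n : ℕ) (s : List Bool) : Fin n → Bool :=
  fun i => s.reverse.getD i false

/-- The value obtained by the algorithm: that of the best solution it has at the end. -/
def value (A : OnlineAlgorithm) {n : ℕ} (I : Instance n) : ℕ :=
  (A.level n (I.history n)).sup fun s => I.numSat (toAssignment n s)

/-- The asymptotic approximation ratio: `liminf` over `n` of the infimum over the instances of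
size `n` of the ratio of the value obtained to the optimal value. -/
noncomputable def asymptoticRatio (A : OnlineAlgorithm) : ℝ≥0∞ :=
  Filter.liminf (fun n : ℕ => ⨅ I : Instance n, (A.value I : ℝ≥0∞) / (I.opt : ℝ≥0∞)) Filter.atTop

end OnlineAlgorithm

end MaxSat

/-!
Every complete solution kept by an algorithm of width `k` is the outcome of one of the `2 ^ k`
non-branching strategies that fix in advance, for each `j < k`, the value chosen when the tree
branches on a level of cardinality `j`. It thus suffices to beat `m = 2 ^ k` strategies at once.

For a weighted average of `m` strategies, the adversary plays a gadget on `2 ^ m` fresh clauses: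
the next variable occurs positively in one half of the remaining clauses and negatively in the
other half, and the half chosen by the heavier strategies becomes the set of remaining clauses, so
that these strategies gain nothing more while the lighter ones, at most half of the weight, go on.
The ratio `r m` obtained satisfies `r (m + 1) = 1 / 2 + r m / 4`, hence `r m < 2 / 3`. Giving each
variable the value that the heavier strategies reject satisfies all clauses but one, which is left
to a last variable.

Gadgets are repeated, each strategy being weighted by its current excess over the ratio `r m`. As
in Blackwell's approachability theorem, the sum of the squared excesses then grows linearly in the
number of gadgets, so every single strategy has asymptotic ratio at most `r m`.
-/

namespace MaxSat

open Finset

/-- The clauses of a data item that are satisfied when its variable gets the value `b`. -/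
def DataItem.side (d : DataItem) (b : Bool) : Finset ℕ := if b then d.pos else d.neg

/-- The clauses in which the variable of a data item occurs. -/
def DataItem.clauses (d : DataItem) : Finset ℕ := d.pos ∪ d.neg

namespace DataItem

theorem side_union_side_not (d : DataItem) (b : Bool) : d.side b ∪ d.side (!b) = d.clauses := by
  cases b
  · exact union_comm _ _
  · rfl

theorem side_subset_clauses (d : DataItem) (b : Bool) : d.side b ⊆ d.clauses :=
  d.side_union_side_not b ▸ subset_union_left

theorem exists_clauses_eq_card_side_eq {B : Finset ℕ} {a : ℕ} (hB : #B = 2 * a) :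
    ∃ d : DataItem, d.clauses = B ∧ ∀ b, #(d.side b) = a := by
  obtain ⟨C, hC, hCa⟩ := exists_subset_card_eq (s := B) (n := a) (by lia)
  refine ⟨⟨C, B \ C⟩, union_sdiff_of_subset hC, Bool.forall_bool.2 ⟨?_, hCa⟩⟩
  rw [side, if_neg Bool.false_ne_true, card_sdiff_of_subset hC]
  lia

end DataItem

/-- The clauses satisfied by the partial solution `s` among those of the data items `h`, both with
the most recent entry first. Surplus entries of the longer list are those that came first, and
they are ignored, so only lists of the same length are meaningful. -/
def satSet : List DataItem → List Bool → Finset ℕ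
  | d :: h, b :: s => d.side b ∪ satSet h s
  | _, _ => ∅

theorem satSet_append {h h' : List DataItem} {s s' : List Bool} (hl : s.length = h.length) :
    satSet (h ++ h') (s ++ s') = satSet h s ∪ satSet h' s' := by
  induction h generalizing s with
  | nil => simp [List.eq_nil_of_length_eq_zero hl, satSet]
  | cons d h ih =>
    cases s with
    | nil => simp at hl
    | cons b s => simp [satSet, ih (by simpa using hl), union_assoc]

theorem satSet_subset {h : List DataItem} {B : Finset ℕ} (hB : ∀ d ∈ h, d.clauses ⊆ B)
    (s : List Bool) : satSet h s ⊆ B := by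
  induction h generalizing s with
  | nil => simp [satSet]
  | cons d h ih =>
    obtain ⟨hd, hh⟩ := List.forall_mem_cons.1 hB
    cases s with
    | nil => simp [satSet]
    | cons b s => exact union_subset ((d.side_subset_clauses b).trans hd) (ih hh s)

namespace OnlineAlgorithm

theorem toAssignment_cons_of_lt {n : ℕ} {s : List Bool} {j : Fin n} (hj : j < s.length)
    (b : Bool) : toAssignment n (b :: s) j = toAssignment n s j := by
  rw [toAssignment, toAssignment, List.reverse_cons, List.getD_append _ _ _ _ (by simpa)]

theorem toAssignment_cons_of_eq {n : ℕ} {s : List Bool} {j : Fin n} (hj : j = s.length)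
    (b : Bool) : toAssignment n (b :: s) j = b := by
  simp [toAssignment, hj]

end OnlineAlgorithm

namespace Instance

open OnlineAlgorithm

variable {n : ℕ} (I : Instance n)

theorem mem_side_item {i : Fin n} {b : Bool} {c : ℕ} :
    c ∈ (I.item i).side b ↔ c ∈ I.names ∧ (i, b) ∈ I.lits c := by
  cases b <;> simp [DataItem.side, item]

theorem history_succ {i : ℕ} (hi : i < n) :
    I.history (i + 1) = I.item ⟨i, hi⟩ :: I.history i := by
  simp [history, List.take_succ_eq_append_getElem, hi]

theorem length_history {i : ℕ} (hi : i ≤ n) : (I.history i).length = i := by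
  simpa [history] using hi

theorem mem_satSet_history {s : List Bool} (hs : s.length ≤ n) {c : ℕ} :
    c ∈ satSet (I.history s.length) s ↔
      c ∈ I.names ∧ ∃ j : Fin n, j < s.length ∧ (j, toAssignment n s j) ∈ I.lits c := by
  induction s with
  | nil => simp [history, satSet]
  | cons b s ih =>
    have hlt : s.length < n := hs
    have hsplit (P : Fin n → Prop) :
        (∃ j : Fin n, j < (b :: s).length ∧ P j) ↔
          P ⟨s.length, hlt⟩ ∨ ∃ j : Fin n, j < s.length ∧ P j := by
      constructor
      · rintro ⟨j, hj, hP⟩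
        obtain hj | hj := Nat.lt_succ_iff_lt_or_eq.1 hj
        · exact .inr ⟨j, hj, hP⟩
        · obtain rfl : j = ⟨s.length, hlt⟩ := Fin.ext hj
          exact .inl hP
      · rintro (hP | ⟨j, hj, hP⟩)
        · exact ⟨_, Nat.lt_succ_self _, hP⟩
        · exact ⟨j, Nat.lt_succ_of_lt hj, hP⟩
    have hearlier : (∃ j : Fin n, j < s.length ∧ (j, toAssignment n (b :: s) j) ∈ I.lits c) ↔
        ∃ j : Fin n, j < s.length ∧ (j, toAssignment n s j) ∈ I.lits c :=
      exists_congr fun j => and_congr_right fun hj => by rw [toAssignment_cons_of_lt hj]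
    rw [hsplit, hearlier, toAssignment_cons_of_eq rfl, List.length_cons, I.history_succ hlt, satSet,
      mem_union, I.mem_side_item, ih hlt.le, ← and_or_left]

theorem numSat_toAssignment {s : List Bool} (hs : s.length = n) :
    I.numSat (toAssignment n s) = #(satSet (I.history n) s) := by
  rw [numSat]
  congr 1
  ext c
  subst hs
  rw [I.mem_satSet_history le_rfl, mem_filter]
  simp

theorem card_satSet_history_le_opt {s : List Bool} (hs : s.length = n) :
    #(satSet (I.history n) s) ≤ I.opt :=
  I.numSat_toAssignment hs ▸ le_sup (f := I.numSat) (mem_univ _)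

theorem exists_item_eq (d : Fin n → DataItem) (hd : ∀ i, (d i).clauses.Nonempty) :
    ∃ I : Instance n, I.item = d := by
  have mem_names {i b c} (hc : c ∈ (d i).side b) : c ∈ univ.biUnion fun i => (d i).clauses :=
    mem_biUnion.2 ⟨i, mem_univ i, (d i).side_subset_clauses b hc⟩
  have occurs (i : Fin n) : ∃ c ∈ univ.biUnion fun i => (d i).clauses,
      ∃ b, (i, b) ∈ univ.filter fun l : Literal n => c ∈ (d l.1).side l.2 := by
    obtain ⟨c, hc⟩ := hd i
    obtain hc | hc := mem_union.1 ((d i).side_union_side_not true ▸ hc)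
    · exact ⟨c, mem_names hc, true, by simpa using hc⟩
    · exact ⟨c, mem_names hc, false, by simpa using hc⟩
  let I : Instance n := ⟨_, fun c => univ.filter fun l => c ∈ (d l.1).side l.2, occurs⟩
  have hside (i : Fin n) (b : Bool) : (I.item i).side b = (d i).side b := by
    ext c
    simp only [I, mem_side_item, mem_filter_univ]
    exact and_iff_right_of_imp mem_names
  exact ⟨I, funext fun i => congrArg₂ DataItem.mk (hside i true) (hside i false)⟩

theorem exists_history_eq {h : List DataItem} (hn : h.length = n)
    (hne : ∀ d ∈ h, d.clauses.Nonempty) : ∃ I : Instance n, I.history n = h := by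
  rw [← List.length_reverse] at hn
  subst hn
  obtain ⟨I, hI⟩ := exists_item_eq h.reverse.get fun i => hne _ (List.mem_reverse.1 (by simp))
  exact ⟨I, by rw [history, hI, List.ofFn_get, List.take_length, List.reverse_reverse]⟩

end Instance

/-- A deterministic strategy without branching: given the data items seen so far, that of the
current variable included, and the values of the previous variables, it chooses the value of the
current variable. Both lists have the most recent entry first. -/
def Strategy : Type := List DataItem → List Bool → Bool

namespace Strategy

/-- The solution built by a strategy. -/
def play (β : Strategy) : List DataItem → List Bool
  | [] => []
  | d :: h => β (d :: h) (β.play h) :: β.play h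

/-- The strategy `β` as it continues once the data items `h` have been processed. -/
def after (β : Strategy) (h : List DataItem) : Strategy := fun g s => β (g ++ h) (s ++ β.play h)

/-- The clauses satisfied by the solution that a strategy builds. -/
def satisfied (β : Strategy) (h : List DataItem) : Finset ℕ := satSet h (β.play h)

variable (β : Strategy)

theorem length_play (h : List DataItem) : (β.play h).length = h.length := by
  induction h with
  | nil => rfl
  | cons d h ih => simp [play, ih]

theorem play_append (g h : List DataItem) :
    β.play (g ++ h) = (β.after h).play g ++ β.play h := by
  induction g with
  | nil => rfl
  | cons d g ih => rw [List.cons_append, play, ih, play, after, List.cons_append, List.cons_append]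

theorem satisfied_append (g h : List DataItem) :
    β.satisfied (g ++ h) = (β.after h).satisfied g ∪ β.satisfied h := by
  rw [satisfied, play_append, satSet_append (length_play _ g), satisfied, satisfied]

theorem satisfied_singleton (d : DataItem) : β.satisfied [d] = d.side (β [d] []) :=
  union_empty _

end Strategy

/-- The data items `h` describe a satisfiable formula with the set of clauses `B` in which every
variable occurs. -/
structure IsSatisfiable (h : List DataItem) (B : Finset ℕ) : Prop where
  clauses_nonempty : ∀ d ∈ h, d.clauses.Nonempty
  clauses_subset : ∀ d ∈ h, d.clauses ⊆ B
  exists_satSet_eq : ∃ s : List Bool, s.length = h.length ∧ satSet h s = B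

namespace IsSatisfiable

variable {g h : List DataItem} {B C : Finset ℕ}

theorem nil : IsSatisfiable [] ∅ :=
  ⟨by simp, by simp, [], rfl, rfl⟩

theorem append (hg : IsSatisfiable g B) (hh : IsSatisfiable h C) :
    IsSatisfiable (g ++ h) (B ∪ C) := by
  obtain ⟨s, hs, hsB⟩ := hg.exists_satSet_eq
  obtain ⟨t, ht, htC⟩ := hh.exists_satSet_eq
  exact
    { clauses_nonempty := List.forall_mem_append.2 ⟨hg.clauses_nonempty, hh.clauses_nonempty⟩
      clauses_subset := List.forall_mem_append.2
        ⟨fun d hd => (hg.clauses_subset d hd).trans subset_union_left,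
          fun d hd => (hh.clauses_subset d hd).trans subset_union_right⟩
      exists_satSet_eq := ⟨s ++ t, by simp [hs, ht], by rw [satSet_append hs, hsB, htC]⟩ }

theorem append_singleton {d : DataItem} {b : Bool} (hg : IsSatisfiable g (d.side b))
    (hd : d.clauses.Nonempty) : IsSatisfiable (g ++ [d]) d.clauses := by
  obtain ⟨s, hs, hsat⟩ := hg.exists_satSet_eq
  refine ⟨List.forall_mem_append.2 ⟨hg.clauses_nonempty, by simpa⟩,
    List.forall_mem_append.2 ⟨fun e he => (hg.clauses_subset e he).trans
      (d.side_subset_clauses b), by simp⟩, s ++ [!b], by simp [hs], ?_⟩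
  rw [satSet_append hs, hsat]
  simpa [satSet] using d.side_union_side_not b

theorem singleton (hB : B.Nonempty) : IsSatisfiable [⟨B, ∅⟩] B := by
  have hclauses : DataItem.clauses ⟨B, ∅⟩ = B := union_empty B
  simpa [hclauses, hB] using append_singleton (d := ⟨B, ∅⟩) (b := false) nil

theorem satisfied_subset (hh : IsSatisfiable h B) (β : Strategy) : β.satisfied h ⊆ B :=
  satSet_subset hh.clauses_subset _

end IsSatisfiable

namespace OnlineAlgorithm

variable (A : OnlineAlgorithm) (n : ℕ)

theorem level_nonempty (h : List DataItem) : (A.level n h).Nonempty := by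
  induction h with
  | nil => exact singleton_nonempty []
  | cons d h ih => exact ih.biUnion fun s _ => (A.branch_nonempty n (d :: h) s).image _

theorem length_of_mem_level {h : List DataItem} {s : List Bool} (hs : s ∈ A.level n h) :
    s.length = h.length := by
  induction h generalizing s with
  | nil => simp [mem_singleton.1 hs]
  | cons d h ih =>
    obtain ⟨t, ht, hst⟩ := mem_biUnion.1 hs
    obtain ⟨b, -, rfl⟩ := mem_image.1 hst
    simp [ih ht]

theorem card_level_cons (d : DataItem) (h : List DataItem) :
    #(A.level n (d :: h)) = ∑ s ∈ A.level n h, #(A.branch n (d :: h) s) := by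
  rw [level, card_biUnion]
  · exact sum_congr rfl fun s _ => card_image_of_injective _ fun _ _ hbc => (List.cons.inj hbc).1
  · intro s _ t _ hst
    refine disjoint_left.2 fun u hu hu' => hst ?_
    obtain ⟨b, -, rfl⟩ := mem_image.1 hu
    obtain ⟨c, -, hc⟩ := mem_image.1 hu'
    exact (List.cons.inj hc).2.symm

theorem card_level_le_card_level_cons (d : DataItem) (h : List DataItem) :
    #(A.level n h) ≤ #(A.level n (d :: h)) := by
  rw [card_level_cons, card_eq_sum_ones]
  exact sum_le_sum fun s _ => card_pos.2 (A.branch_nonempty _ _ s)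

theorem card_level_lt_card_level_cons {d : DataItem} {h : List DataItem} {s : List Bool}
    (hs : s ∈ A.level n h) (hbranch : 1 < #(A.branch n (d :: h) s)) :
    #(A.level n h) < #(A.level n (d :: h)) := by
  rw [card_level_cons, card_eq_sum_ones]
  exact sum_lt_sum (fun t _ => card_pos.2 (A.branch_nonempty _ _ t)) ⟨s, hs, hbranch⟩

/-- The strategy that follows one path in the tree of the algorithm, taking the child with value
`c j` at a branching on a level of cardinality `j`. A branching strictly increases the cardinality
of the level, so different branchings on a path use different entries of `c`. -/
def strategy (c : ℕ → Bool) : Strategy := fun h s =>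
  if c #(A.level n h.tail) ∈ A.branch n h s then c #(A.level n h.tail)
  else !c #(A.level n h.tail)

theorem strategy_cons_eq {c : ℕ → Bool} {d : DataItem} {h : List DataItem} {s : List Bool}
    {b : Bool} (hb : b ∈ A.branch n (d :: h) s)
    (hc : 1 < #(A.branch n (d :: h) s) → c #(A.level n h) = b) :
    A.strategy n c (d :: h) s = b := by
  rw [strategy, List.tail_cons]
  by_cases hcb : c #(A.level n h) = b
  · rw [hcb, if_pos hb]
  · rw [if_neg fun hmem => hcb (hc (one_lt_card.2 ⟨_, hmem, b, hb, hcb⟩)), Bool.not_eq.2 hcb]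

theorem exists_forall_eqOn_play_strategy_eq {h : List DataItem} {s : List Bool}
    (hs : s ∈ A.level n h) :
    ∃ c : ℕ → Bool, ∀ c', Set.EqOn c' c (Set.Iio #(A.level n h)) →
      (A.strategy n c').play h = s := by
  induction h generalizing s with
  | nil => exact ⟨fun _ => false, fun _ _ => (mem_singleton.1 hs).symm⟩
  | cons d h ih =>
    obtain ⟨t, ht, hst⟩ := mem_biUnion.1 hs
    obtain ⟨b, hb, rfl⟩ := mem_image.1 hst
    obtain ⟨c, hc⟩ := ih ht
    refine ⟨Function.update c #(A.level n h) b, fun c' hc' => ?_⟩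
    have hplay : (A.strategy n c').play h = t := hc c' fun j hj => by
      rw [hc' (hj.trans_le (A.card_level_le_card_level_cons n d h)),
        Function.update_of_ne (ne_of_lt hj)]
    rw [Strategy.play, hplay, A.strategy_cons_eq n hb fun hbranch => ?_]
    rw [hc' (A.card_level_lt_card_level_cons n ht hbranch), Function.update_self]

theorem exists_play_strategy_eq {k : ℕ} {h : List DataItem} (hk : #(A.level n h) ≤ k)
    {s : List Bool} (hs : s ∈ A.level n h) :
    ∃ c : Fin k → Bool,
      (A.strategy n (Function.extend Fin.val c fun _ => false)).play h = s := by
  obtain ⟨c, hc⟩ := A.exists_forall_eqOn_play_strategy_eq n hs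
  exact ⟨fun j => c j, hc _ fun j hj =>
    Fin.val_injective.extend_apply _ _ (⟨j, hj.trans_le hk⟩ : Fin k)⟩

variable {A n}

theorem HasWidth.exists_value_eq {k : ℕ} (hA : A.HasWidth k) (I : Instance n) :
    ∃ c : Fin k → Bool, A.value I =
      #((A.strategy n (Function.extend Fin.val c fun _ => false)).satisfied (I.history n)) := by
  obtain ⟨s, hs, hvalue⟩ := exists_mem_eq_sup _ (A.level_nonempty n (I.history n))
    fun s => I.numSat (toAssignment n s)
  obtain ⟨c, hc⟩ := A.exists_play_strategy_eq n (hA n I n le_rfl) hs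
  have hlength : s.length = n := (A.length_of_mem_level n hs).trans (I.length_history le_rfl)
  exact ⟨c, by rw [value, hvalue, I.numSat_toAssignment hlength, Strategy.satisfied, hc]⟩

end OnlineAlgorithm

/-- The ratio `r m` that the gadget with `2 ^ m` clauses enforces against a weighted average of
`m` strategies. -/
noncomputable def gadgetRatio (m : ℕ) : ℝ := 2 / 3 * (1 - (1 / 4) ^ m)

theorem gadgetRatio_succ (m : ℕ) : gadgetRatio (m + 1) = 1 / 2 + gadgetRatio m / 4 := by
  rw [gadgetRatio, gadgetRatio]
  ring

theorem gadgetRatio_nonneg (m : ℕ) : 0 ≤ gadgetRatio m :=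
  mul_nonneg (by norm_num) (sub_nonneg.2 (pow_le_one₀ (by norm_num) (by norm_num)))

theorem gadgetRatio_lt (m : ℕ) : gadgetRatio m < 2 / 3 := by
  have : (0 : ℝ) < (1 / 4) ^ m := by positivity
  rw [gadgetRatio]
  linarith

section Gadget

variable {ι : Type*}

theorem exists_sum_filter_not_le_sum_filter (S : Finset ι) {w : ι → ℝ} (hw : ∀ i ∈ S, 0 ≤ w i)
    (f : ι → Bool) :
    ∃ b, ∑ i ∈ S with f i = !b, w i ≤ ∑ i ∈ S with f i = b, w i ∧
      #{i ∈ S | f i = !b} ≤ #S - 1 := by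
  obtain ⟨b, hb⟩ : ∃ b, ∑ i ∈ S with f i = !b, w i ≤ ∑ i ∈ S with f i = b, w i := by
    obtain hle | hle := le_total (∑ i ∈ S with f i = true, w i) (∑ i ∈ S with f i = false, w i)
    · exact ⟨false, hle⟩
    · exact ⟨true, hle⟩
  obtain hempty | ⟨i, hi⟩ := ({i ∈ S | f i = b} : Finset ι).eq_empty_or_nonempty
  · refine ⟨!b, ?_, ?_⟩ <;> rw [Bool.not_not, hempty]
    · exact sum_nonneg fun i hi => hw i (mem_of_mem_filter i hi)
    · exact Nat.zero_le _
  · obtain ⟨hiS, hib⟩ := mem_filter.1 hi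
    have hssubset : {i ∈ S | f i = !b} ⊂ S := filter_ssubset.2 ⟨i, hiS, by simp [hib]⟩
    exact ⟨b, hb, Nat.le_sub_one_of_lt (card_lt_card hssubset)⟩

theorem sum_card_satisfied_append_singleton_le {S : Finset ι} {w : ι → ℝ}
    (hw : ∀ i ∈ S, 0 ≤ w i) (β : ι → Strategy) {g : List DataItem} {d : DataItem} {b : Bool}
    {a : ℕ} (hd : ∀ b, #(d.side b) = a) (hg : IsSatisfiable g (d.side b)) :
    ∑ i ∈ S, w i * #((β i).satisfied (g ++ [d])) ≤ a * ∑ i ∈ S, w i +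
      ∑ i ∈ S with β i [d] [] = !b, w i * #(((β i).after [d]).satisfied g) := by
  rw [mul_sum, sum_filter, ← sum_add_distrib]
  refine sum_le_sum fun i hi => ?_
  rw [mul_comm (a : ℝ), Strategy.satisfied_append, Strategy.satisfied_singleton]
  split_ifs with hib
  · rw [← mul_add, ← Nat.cast_add]
    refine mul_le_mul_of_nonneg_left (Nat.cast_le.2 ?_) (hw i hi)
    rw [add_comm, ← hd (β i [d] [])]
    exact card_union_le _ _
  · rw [Bool.eq_not_iff.not_left.1 hib, union_eq_right.2 (hg.satisfied_subset _), hd, add_zero]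

theorem exists_gadget (m : ℕ) {S : Finset ι} (hS : #S ≤ m) {w : ι → ℝ} (hw : ∀ i ∈ S, 0 ≤ w i)
    (β : ι → Strategy) {B : Finset ℕ} (hB : #B = 2 ^ m) :
    ∃ g, IsSatisfiable g B ∧ g.length = m + 1 ∧
      ∑ i ∈ S, w i * #((β i).satisfied g) ≤ gadgetRatio m * 2 ^ m * ∑ i ∈ S, w i := by
  have hB₀ : B.Nonempty := card_pos.1 (hB ▸ by positivity)
  induction m generalizing S β B with
  | zero =>
    obtain rfl := card_eq_zero.1 (Nat.le_zero.1 hS)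
    exact ⟨[⟨B, ∅⟩], .singleton hB₀, rfl, by simp⟩
  | succ m ih =>
    obtain ⟨d, rfl, hd⟩ := DataItem.exists_clauses_eq_card_side_eq (hB.trans (pow_succ' 2 m))
    obtain ⟨b, hweight, hcard⟩ := exists_sum_filter_not_le_sum_filter S hw fun i => β i [d] []
    obtain ⟨g, hg, hlength, hsum⟩ := ih (hcard.trans (by lia))
      (fun i hi => hw i (mem_of_mem_filter i hi)) (fun i => (β i).after [d]) (hd b)
      (card_pos.1 (by simp [hd]))
    refine ⟨g ++ [d], hg.append_singleton hB₀, by simp [hlength], ?_⟩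
    have hhalf : 2 * ∑ i ∈ S with β i [d] [] = !b, w i ≤ ∑ i ∈ S, w i := by
      have := sum_filter_add_sum_filter_not S (fun i => β i [d] [] = b) w
      simp only [← Bool.eq_not] at this
      linarith
    have hscale : 0 ≤ gadgetRatio m * 2 ^ m := mul_nonneg (gadgetRatio_nonneg m) (by positivity)
    calc ∑ i ∈ S, w i * #((β i).satisfied (g ++ [d]))
        ≤ (2 ^ m : ℕ) * ∑ i ∈ S, w i +
          ∑ i ∈ S with β i [d] [] = !b, w i * #(((β i).after [d]).satisfied g) :=
          sum_card_satisfied_append_singleton_le hw β hd hg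
      _ ≤ 2 ^ m * ∑ i ∈ S, w i +
          gadgetRatio m * 2 ^ m * ∑ i ∈ S with β i [d] [] = !b, w i := by
          push_cast
          gcongr
      _ ≤ gadgetRatio (m + 1) * 2 ^ (m + 1) * ∑ i ∈ S, w i := by
          rw [gadgetRatio_succ, pow_succ]
          linarith [mul_le_mul_of_nonneg_left hhalf hscale]

theorem posPart_add_sq_le (x d : ℝ) : (x + d)⁺ ^ 2 ≤ x⁺ ^ 2 + 2 * (x⁺ * d) + d ^ 2 := by
  have habs : (x + d)⁺ ≤ |x⁺ + d| :=
    sup_le ((add_le_add_left (le_posPart x) d).trans (le_abs_self _)) (abs_nonneg _)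
  calc (x + d)⁺ ^ 2 ≤ |x⁺ + d| ^ 2 := pow_le_pow_left₀ (posPart_nonneg _) habs 2
    _ = x⁺ ^ 2 + 2 * (x⁺ * d) + d ^ 2 := by rw [sq_abs]; ring

theorem sum_posPart_add_sq_le [Fintype ι] {x d : ι → ℝ} {L : ℝ} (hd : ∀ i, |d i| ≤ L)
    (hxd : ∑ i, (x i)⁺ * d i ≤ 0) :
    ∑ i, (x i + d i)⁺ ^ 2 ≤ ∑ i, (x i)⁺ ^ 2 + Fintype.card ι * L ^ 2 :=
  calc ∑ i, (x i + d i)⁺ ^ 2 ≤ ∑ i, ((x i)⁺ ^ 2 + 2 * ((x i)⁺ * d i) + L ^ 2) :=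
        sum_le_sum fun i _ => (posPart_add_sq_le _ _).trans <|
          add_le_add_right (sq_le_sq.2 ((hd i).trans (le_abs_self L))) _
    _ = ∑ i, (x i)⁺ ^ 2 + 2 * ∑ i, (x i)⁺ * d i + Fintype.card ι * L ^ 2 := by
        simp [sum_add_distrib, mul_sum]
    _ ≤ ∑ i, (x i)⁺ ^ 2 + Fintype.card ι * L ^ 2 := by linarith

variable [Fintype ι]

theorem exists_gadget_append {m : ℕ} (hm : Fintype.card ι ≤ m) (β : ι → Strategy)
    {h : List DataItem} {M : ℕ} (hh : IsSatisfiable h (range M)) (t : ℝ) :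
    ∃ g, IsSatisfiable (g ++ h) (range (M + 2 ^ m)) ∧ g.length = m + 1 ∧
      ∑ i, (#((β i).satisfied (g ++ h)) - (t + gadgetRatio m * 2 ^ m))⁺ ^ 2 ≤
        ∑ i, (#((β i).satisfied h) - t)⁺ ^ 2 + Fintype.card ι * (2 ^ m) ^ 2 := by
  obtain ⟨g, hg, hlength, hsum⟩ := exists_gadget m (S := univ) hm
    (w := fun i => (#((β i).satisfied h) - t)⁺) (fun i _ => posPart_nonneg _)
    (fun i => (β i).after h) (B := Ico M (M + 2 ^ m)) (by simp)
  have hdisjoint : Disjoint (Ico M (M + 2 ^ m)) (range M) :=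
    disjoint_left.2 fun c hc hc' => (mem_Ico.1 hc).1.not_gt (mem_range.1 hc')
  have hunion : Ico M (M + 2 ^ m) ∪ range M = range (M + 2 ^ m) := by
    rw [range_eq_Ico, range_eq_Ico, union_comm,
      Ico_union_Ico_eq_Ico M.zero_le (Nat.le_add_right ..)]
  refine ⟨g, hunion ▸ hg.append hh, hlength, ?_⟩
  have hstep (i : ι) : (#((β i).satisfied (g ++ h)) : ℝ) - (t + gadgetRatio m * 2 ^ m) =
      (#((β i).satisfied h) - t) + (#(((β i).after h).satisfied g) - gadgetRatio m * 2 ^ m) := by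
    rw [Strategy.satisfied_append, card_union_of_disjoint
      (hdisjoint.mono (hg.satisfied_subset _) (hh.satisfied_subset _))]
    push_cast
    ring
  simp only [hstep]
  refine sum_posPart_add_sq_le (fun i => ?_) ?_
  · have hle : (#(((β i).after h).satisfied g) : ℝ) ≤ 2 ^ m := by
      exact_mod_cast (card_le_card (hg.satisfied_subset _)).trans_eq (by simp)
    have hratio : gadgetRatio m * 2 ^ m ≤ 2 ^ m :=
      mul_le_of_le_one_left (by positivity) (by linarith [gadgetRatio_lt m])
    exact abs_sub_le_of_nonneg_of_le (Nat.cast_nonneg _) hle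
      (mul_nonneg (gadgetRatio_nonneg m) (by positivity)) hratio
  · simp only [mul_sub, sum_sub_distrib, ← sum_mul]
    linarith

theorem exists_repeated_gadget {m : ℕ} (hm : Fintype.card ι ≤ m) (β : ι → Strategy) (N : ℕ) :
    ∃ h, IsSatisfiable h (range (N * 2 ^ m)) ∧ h.length = N * (m + 1) ∧
      ∑ i, (#((β i).satisfied h) - N * (gadgetRatio m * 2 ^ m))⁺ ^ 2 ≤
        N * (Fintype.card ι * (2 ^ m) ^ 2) := by
  induction N with
  | zero => exact ⟨[], by simpa using .nil, by simp, by simp [Strategy.satisfied, satSet]⟩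
  | succ N ih =>
    obtain ⟨h, hh, hlength, hsum⟩ := ih
    obtain ⟨g, hgh, hglength, hgsum⟩ :=
      exists_gadget_append hm β hh (N * (gadgetRatio m * 2 ^ m))
    refine ⟨g ++ h, by rwa [Nat.succ_mul], by rw [List.length_append, hglength, hlength]; ring, ?_⟩
    push_cast
    simp only [add_one_mul]
    linarith

theorem exists_card_satisfied_le {m : ℕ} (hm : Fintype.card ι ≤ m) (β : ι → Strategy) {ε : ℝ}
    (hε : 0 ≤ ε) {N : ℕ} (hN : Fintype.card ι ≤ ε ^ 2 * N) :
    ∃ h, IsSatisfiable h (range (N * 2 ^ m)) ∧ h.length = N * (m + 1) ∧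
      ∀ i, #((β i).satisfied h) ≤ (gadgetRatio m + ε) * (N * 2 ^ m : ℕ) := by
  obtain ⟨h, hh, hlength, hsum⟩ := exists_repeated_gadget hm β N
  refine ⟨h, hh, hlength, fun i => ?_⟩
  have hsq : (#((β i).satisfied h) - N * (gadgetRatio m * 2 ^ m))⁺ ^ 2 ≤ (ε * (N * 2 ^ m)) ^ 2 :=
    calc (#((β i).satisfied h) - N * (gadgetRatio m * 2 ^ m))⁺ ^ 2
        ≤ ∑ i, (#((β i).satisfied h) - N * (gadgetRatio m * 2 ^ m))⁺ ^ 2 :=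
          single_le_sum (f := fun i => (#((β i).satisfied h) - N * (gadgetRatio m * 2 ^ m))⁺ ^ 2)
            (fun _ _ => sq_nonneg _) (mem_univ i)
      _ ≤ N * (Fintype.card ι * (2 ^ m) ^ 2) := hsum
      _ ≤ N * (ε ^ 2 * N * (2 ^ m) ^ 2) := by gcongr
      _ = (ε * (N * 2 ^ m)) ^ 2 := by ring
  have hexcess := (le_posPart _).trans (le_of_sq_le_sq hsq (by positivity))
  push_cast
  linarith

end Gadget

namespace OnlineAlgorithm.HasWidth

variable {k : ℕ} {A : OnlineAlgorithm}

theorem exists_value_le (hA : A.HasWidth k) {ε : ℝ} (hε : 0 ≤ ε) {N : ℕ}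
    (hN : (2 : ℝ) ^ k ≤ ε ^ 2 * N) :
    ∃ I : Instance (N * (2 ^ k + 1)), A.value I ≤ (gadgetRatio (2 ^ k) + ε) * I.opt := by
  obtain ⟨h, hh, hlength, hsat⟩ := exists_card_satisfied_le (ι := Fin k → Bool) (m := 2 ^ k)
    (by simp) (fun c => A.strategy (N * (2 ^ k + 1)) (Function.extend Fin.val c fun _ => false))
    hε (by simpa using hN)
  obtain ⟨I, rfl⟩ := Instance.exists_history_eq hlength hh.clauses_nonempty
  obtain ⟨s, hs, hsB⟩ := hh.exists_satSet_eq
  have hopt : N * 2 ^ 2 ^ k ≤ I.opt := by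
    simpa [hsB] using I.card_satSet_history_le_opt (hs.trans hlength)
  obtain ⟨c, hc⟩ := hA.exists_value_eq I
  refine ⟨I, hc ▸ (hsat c).trans ?_⟩
  exact mul_le_mul_of_nonneg_left (Nat.cast_le.2 hopt) (add_nonneg (gadgetRatio_nonneg _) hε)

theorem exists_value_div_opt_le (hA : A.HasWidth k) {ε : ℝ} (hε : 0 ≤ ε) {N : ℕ}
    (hN : (2 : ℝ) ^ k ≤ ε ^ 2 * N) :
    ∃ I : Instance (N * (2 ^ k + 1)),
      (A.value I / I.opt : ℝ≥0∞) ≤ ENNReal.ofReal (gadgetRatio (2 ^ k) + ε) := by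
  obtain ⟨I, hI⟩ := hA.exists_value_le hε hN
  refine ⟨I, ENNReal.div_le_of_le_mul ?_⟩
  rw [← ENNReal.ofReal_natCast, ← ENNReal.ofReal_natCast,
    ← ENNReal.ofReal_mul (add_nonneg (gadgetRatio_nonneg _) hε)]
  exact ENNReal.ofReal_le_ofReal hI

theorem asymptoticRatio_le (hA : A.HasWidth k) :
    A.asymptoticRatio ≤ ENNReal.ofReal (gadgetRatio (2 ^ k)) := by
  refine ENNReal.le_of_forall_pos_le_add fun ε hε _ => ?_
  rw [← ENNReal.ofReal_coe_nnreal, ← ENNReal.ofReal_add (gadgetRatio_nonneg _) ε.coe_nonneg]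
  have hlarge : ∀ᶠ N : ℕ in Filter.atTop, (2 : ℝ) ^ k ≤ ε ^ 2 * N :=
    (tendsto_natCast_atTop_atTop.const_mul_atTop (by positivity)).eventually_ge_atTop _
  have hsize : Filter.Tendsto (fun N : ℕ => N * (2 ^ k + 1)) Filter.atTop Filter.atTop :=
    Filter.tendsto_id.atTop_mul_const' (by positivity)
  refine Filter.liminf_le_of_frequently_le' <|
    hsize.frequently (hlarge.mono fun N hN => ?_).frequently
  obtain ⟨I, hI⟩ := hA.exists_value_div_opt_le ε.coe_nonneg hN
  exact (iInf_le _ I).trans hI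

end OnlineAlgorithm.HasWidth

end MaxSat

theorem mainTheorem7 (k : ℕ) (A : MaxSat.OnlineAlgorithm) (hA : A.HasWidth k) :
    A.asymptoticRatio < 2 / 3 := by
  calc A.asymptoticRatio ≤ ENNReal.ofReal (MaxSat.gadgetRatio (2 ^ k)) := hA.asymptoticRatio_le
    _ < ENNReal.ofReal (2 / 3) :=
      (ENNReal.ofReal_lt_ofReal_iff (by norm_num)).2 (MaxSat.gadgetRatio_lt _)
    _ = 2 / 3 := by rw [ENNReal.ofReal_div_of_pos (by norm_num)]; simp
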